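/- Let $k$ be a field of arbitrary characteristic and let $a,b,c\ge 2$ be integers with $\gcd(a,b,c)=1$. Then for every polynomial $F(Y)\in k[Y]$, the $k$-algebra $$D:=\frac{k[X,Y,Z]}{(X^a+Y^bZ^c+F(Y))}$$ is a rigid domain; that is, $D$ is an integral domain and it admits no non-trivial exponential map. Here an exponential map on a $k$-algebra $A$ is a $k$-algebra homomorphism $\phi=\phi_U:A\to A[U]$ such that (i) $\varepsilon_0\circ\phi_U=\mathrm{id}_A$, where $\varepsilon_0:A[U]\to A$ is evaluation at $U=0$, and (ii) $\phi_V\circ\phi_U=\phi_{V+U}$, where $\phi_V:A\to A[V]$ is extended to a homomorphism $A[U]\to A[U,V]$ by $\phi_V(U)=U$; it is non-trivial if its ring of invariants $A^\phi=\{a\in A : \phi(a)=a\}$ is not equal to $A$. -/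

import Mathlib

open scoped Polynomial

/-- A `k`-algebra homomorphism `φ = φ_U : A → A[U]` is an exponential map on `A` if
* `ε₀ ∘ φ_U = id`, where `ε₀ : A[U] → A` is evaluation at `U = 0`;
* `φ_V ∘ φ_U = φ_{V+U}`, where `φ_V` is extended to `A[U] → A[U, V]` by `U ↦ U`.

Here `A[U, V]` is `A[X][X]`, with `V` the inner variable (`Polynomial.C Polynomial.X`) and `U` the
outer variable (`Polynomial.X`); the extension of `φ_V` acts on coefficients, and `φ_{V+U}` is `φ`
followed by the substitution `U ↦ V + U`. -/
structure IsExponentialMap {k A : Type*} [CommRing k] [CommRing A] [Algebra k A]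
    (φ : A →ₐ[k] A[X]) : Prop where
  eval_zero : ∀ a : A, (φ a).eval 0 = a
  comp : ∀ a : A, (φ a).map (φ : A →+* A[X]) =
    Polynomial.aeval (Polynomial.C Polynomial.X + Polynomial.X : A[X][X]) (φ a)

/-- The ring of invariants `A^φ = {a ∈ A | φ(a) = a}`. -/
noncomputable def expInvariants {k A : Type*} [CommRing k] [CommRing A] [Algebra k A]
    (φ : A →ₐ[k] A[X]) : Subalgebra k A :=
  AlgHom.equalizer φ Polynomial.CAlgHom

/-- A `k`-algebra `A` is rigid if it has no non-trivial exponential map, i.e. no exponential map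
`φ` with `A^φ ≠ A`. -/
def IsRigid (k A : Type*) [CommRing k] [CommRing A] [Algebra k A] : Prop :=
  ¬ ∃ φ : A →ₐ[k] A[X], IsExponentialMap φ ∧ expInvariants φ ≠ ⊤

/-- The polynomial `X^a + Y^b Z^c + F(Y)` in `k[X, Y, Z]`, where `X`, `Y`, `Z` are the variables
numbered `0`, `1`, `2`. -/
noncomputable def surfacePoly {k : Type*} [CommRing k] (a b c : ℕ) (F : k[X]) :
    MvPolynomial (Fin 3) k :=
  MvPolynomial.X 0 ^ a + MvPolynomial.X 1 ^ b * MvPolynomial.X 2 ^ c +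
    Polynomial.aeval (MvPolynomial.X 1 : MvPolynomial (Fin 3) k) F

/-- The `k`-algebra `k[X, Y, Z] / (X^a + Y^b Z^c + F(Y))`. -/
abbrev SurfaceRing (k : Type*) [CommRing k] (a b c : ℕ) (F : k[X]) : Type _ :=
  MvPolynomial (Fin 3) k ⧸ Ideal.span {surfacePoly a b c F}

/-!
Give `X`, `Y`, `Z` the real weights `b + c ξ`, `a`, `a ξ`, with `ξ` irrational and larger than the
degree of `F`. Then `X ^ a` and `Y ^ b Z ^ c` have equal weight, `F(Y)` has smaller weight, and, as
`gcd(a, b, c) = 1`, distinct monomials of degree less than `a` in `X` have distinct weights. So the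
surface ring is filtered by the weight, and each nonzero element has the weight of a monomial and
a leading value in `k`, obtained by evaluating a top-weight component at a zero `ε` of
`X ^ a + Y ^ b Z ^ c` with nonzero coordinates (`exists_isLead`, `isLead_unique`). Leading values
multiply (`IsLead.mul`), so the ring is a domain.

Let `φ` be a nontrivial exponential map. Let `δ` be the largest growth of weight per degree among
the coefficients of the images of the three generators. The leading values of the coefficients
that attain this growth form the symbols `x, y, z ∈ k[U]` of the generators. They are not all
constant, and they satisfy `x ^ a + y ^ b z ^ c = 0`. A nonzero coefficient of degree `n` of a
monomial in the symbols, of weight `γ`, forces `γ + n δ` to be the weight of a monomial; if `n` is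
the degree, the symbol of this second monomial is constant, by the iterative law
(`IsExponentialMap.exists_symbols`).

No such symbols exist (`symbols_false`). If neither `y` nor `z` is constant, the weights of `Y` and
`Z` are both integer multiples of `δ`, although their ratio `ξ` is irrational. Otherwise exactly one
of them is constant, say `y`. Then `gcd(a, c) = 1`, and up to constants `x = P ^ c` and `z = P ^ a`
with `P` of some degree `e > 0` and `P(0) ≠ 0`. One of `a`, `c` is invertible in `k`, so one of these
powers has a second term at distance at most `e` from the leading one. But the distance divided by
`e` has to lie in the numerical semigroup generated by `a` and `c`, whose smallest nonzero element
is at least `2`.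
-/

/-! ### Polynomials of bounded weight -/

section WeightLE

variable {k σ : Type*} [Field k] {w : σ → ℝ} {γ γ' : ℝ} {f g : MvPolynomial σ k}

/-- All monomials of `f` have weight at most `γ`. -/
def WeightLE (w : σ → ℝ) (γ : ℝ) (f : MvPolynomial σ k) : Prop :=
  ∀ m ∈ f.support, Finsupp.weight w m ≤ γ

theorem WeightLE.mono (h : WeightLE w γ f) (hγ : γ ≤ γ') : WeightLE w γ' f :=
  fun m hm => (h m hm).trans hγ

theorem weightLE_zero : WeightLE w γ (0 : MvPolynomial σ k) := by
  intro m hm; simp at hm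

theorem weightLE_monomial (m : σ →₀ ℕ) (r : k) :
    WeightLE w (Finsupp.weight w m) (MvPolynomial.monomial m r) := by
  classical
  intro n hn
  rw [Finset.mem_singleton.mp (MvPolynomial.support_monomial_subset hn)]

theorem WeightLE.add (hf : WeightLE w γ f) (hg : WeightLE w γ g) : WeightLE w γ (f + g) := by
  classical
  intro m hm
  rcases Finset.mem_union.mp (MvPolynomial.support_add hm) with h | h
  exacts [hf m h, hg m h]

theorem WeightLE.mul (hf : WeightLE w γ f) (hg : WeightLE w γ' g) :
    WeightLE w (γ + γ') (f * g) := by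
  classical
  intro m hm
  obtain ⟨p, hp, q, hq, rfl⟩ := Finset.mem_add.mp (MvPolynomial.support_mul f g hm)
  rw [map_add]
  exact add_le_add (hf p hp) (hg q hq)

theorem WeightLE.smul (r : k) (hf : WeightLE w γ f) : WeightLE w γ (r • f) :=
  fun m hm => hf m (MvPolynomial.support_smul hm)

theorem WeightLE.component_eq_zero (hf : WeightLE w γ f) (h : γ < γ') :
    MvPolynomial.weightedHomogeneousComponent w γ' f = 0 :=
  MvPolynomial.weightedHomogeneousComponent_eq_zero' _ _
    fun m hm => ((hf m hm).trans_lt h).ne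

/-- Every nonzero polynomial has a nonzero homogeneous component of maximal weight. -/
theorem exists_weightLE_component_ne_zero (w : σ → ℝ) (hf : f ≠ 0) :
    ∃ m ∈ f.support, WeightLE w (Finsupp.weight w m) f ∧
      MvPolynomial.weightedHomogeneousComponent w (Finsupp.weight w m) f ≠ 0 := by
  classical
  obtain ⟨m, hm, hmax⟩ := f.support.exists_max_image (Finsupp.weight w)
    (MvPolynomial.support_nonempty.mpr hf)
  refine ⟨m, hm, hmax, fun h => ?_⟩
  have := congrArg (MvPolynomial.coeff m) h
  rw [MvPolynomial.coeff_weightedHomogeneousComponent, if_pos rfl, MvPolynomial.coeff_zero] at this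
  exact MvPolynomial.mem_support_iff.mp hm this

/-- Top-weight components multiply. -/
theorem WeightLE.component_mul (hf : WeightLE w γ f) (hg : WeightLE w γ' g) :
    MvPolynomial.weightedHomogeneousComponent w (γ + γ') (f * g) =
      MvPolynomial.weightedHomogeneousComponent w γ f *
        MvPolynomial.weightedHomogeneousComponent w γ' g := by
  classical
  ext m
  rw [MvPolynomial.coeff_weightedHomogeneousComponent, MvPolynomial.coeff_mul,
    MvPolynomial.coeff_mul]
  simp only [MvPolynomial.coeff_weightedHomogeneousComponent]
  have key : ∀ x ∈ Finset.HasAntidiagonal.antidiagonal m,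
      (if Finsupp.weight w m = γ + γ' then
        MvPolynomial.coeff x.1 f * MvPolynomial.coeff x.2 g else 0) =
      (if Finsupp.weight w x.1 = γ then MvPolynomial.coeff x.1 f else 0) *
        if Finsupp.weight w x.2 = γ' then MvPolynomial.coeff x.2 g else 0 := by
    intro x hx
    rw [← Finset.HasAntidiagonal.mem_antidiagonal.mp hx, map_add]
    by_cases h1 : MvPolynomial.coeff x.1 f = 0
    · simp [h1]
    by_cases h2 : MvPolynomial.coeff x.2 g = 0
    · simp [h2]
    have h1 := hf _ (MvPolynomial.mem_support_iff.mpr h1)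
    have h2 := hg _ (MvPolynomial.mem_support_iff.mpr h2)
    rcases h1.eq_or_lt with h1 | h1
    · simp [h1]
    · rw [if_neg (add_lt_add_of_lt_of_le h1 h2).ne, if_neg h1.ne, zero_mul]
  rw [← Finset.sum_congr rfl key]
  split_ifs <;> simp

end WeightLE

/-! ### Leading values in a quotient of a polynomial ring -/

section Lead

variable {k σ A : Type*} [Field k] [CommRing A] [Algebra k A]

/-- `d` is the image under `π` of a polynomial all of whose monomials have weight at most `γ`,
and whose component of weight `γ` takes the value `c` at `ε`. The value `c = 0` is allowed. When
the components of highest weight of the elements of `ker π` vanish at `ε`, the value `c` is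
determined by `d` and `γ`. -/
def IsLead (π : MvPolynomial σ k →ₐ[k] A) (w : σ → ℝ) (ε : σ → k) (γ : ℝ) (d : A) (c : k) : Prop :=
  ∃ f, π f = d ∧ WeightLE w γ f ∧
    MvPolynomial.eval ε (MvPolynomial.weightedHomogeneousComponent w γ f) = c

variable {π : MvPolynomial σ k →ₐ[k] A} {w : σ → ℝ} {ε : σ → k} {γ γ' : ℝ} {d d' : A} {c c' : k}

namespace IsLead

theorem zero : IsLead π w ε γ 0 0 :=
  ⟨0, map_zero _, weightLE_zero, by simp⟩

theorem add (h : IsLead π w ε γ d c) (h' : IsLead π w ε γ d' c') :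
    IsLead π w ε γ (d + d') (c + c') := by
  obtain ⟨f, rfl, hf, rfl⟩ := h
  obtain ⟨g, rfl, hg, rfl⟩ := h'
  exact ⟨f + g, map_add _ _ _, hf.add hg, by simp⟩

theorem smul (r : k) (h : IsLead π w ε γ d c) : IsLead π w ε γ (r • d) (r * c) := by
  obtain ⟨f, rfl, hf, rfl⟩ := h
  exact ⟨r • f, map_smul _ _ _, hf.smul r, by simp [MvPolynomial.smul_eval]⟩

theorem sum {ι : Type*} (s : Finset ι) {d : ι → A} {c : ι → k}
    (h : ∀ i ∈ s, IsLead π w ε γ (d i) (c i)) :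
    IsLead π w ε γ (∑ i ∈ s, d i) (∑ i ∈ s, c i) := by
  classical
  induction s using Finset.induction_on with
  | empty => simpa using zero
  | insert i s hi ih =>
    rw [Finset.sum_insert hi, Finset.sum_insert hi]
    exact (h i (by simp)).add (ih fun j hj => h j (by simp [hj]))

theorem mul (h : IsLead π w ε γ d c) (h' : IsLead π w ε γ' d' c') :
    IsLead π w ε (γ + γ') (d * d') (c * c') := by
  obtain ⟨f, rfl, hf, rfl⟩ := h
  obtain ⟨g, rfl, hg, rfl⟩ := h'
  exact ⟨f * g, map_mul _ _ _, hf.mul hg, by rw [hf.component_mul hg, map_mul]⟩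

theorem of_lt (h : IsLead π w ε γ d c) (hγ : γ < γ') : IsLead π w ε γ' d 0 := by
  obtain ⟨f, rfl, hf, rfl⟩ := h
  exact ⟨f, rfl, hf.mono hγ.le, by rw [hf.component_eq_zero hγ, map_zero]⟩

theorem of_monomial (π : MvPolynomial σ k →ₐ[k] A) (w : σ → ℝ) (ε : σ → k) (m : σ →₀ ℕ) :
    IsLead π w ε (Finsupp.weight w m) (π (MvPolynomial.monomial m 1))
      (m.prod fun s e => ε s ^ e) := by
  refine ⟨_, rfl, weightLE_monomial _ _, ?_⟩
  rw [(MvPolynomial.isWeightedHomogeneous_monomial w m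
      (1 : k) rfl).weightedHomogeneousComponent_same, MvPolynomial.eval_monomial, one_mul]

/-- The leading value of `d` in weight `γ` does not depend on the representative: representatives
differ by a multiple of `G`, its top component is a multiple of that of `G`, and the latter
vanishes at `ε`. -/
theorem unique {G : MvPolynomial σ k} {γ₀ : ℝ} (hker : RingHom.ker π = Ideal.span {G})
    (hG : WeightLE w γ₀ G) (hG0 : MvPolynomial.weightedHomogeneousComponent w γ₀ G ≠ 0)
    (hGε : MvPolynomial.eval ε (MvPolynomial.weightedHomogeneousComponent w γ₀ G) = 0)
    (h : IsLead π w ε γ d c) (h' : IsLead π w ε γ d c') : c = c' := by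
  obtain ⟨f, rfl, hf, rfl⟩ := h
  obtain ⟨g, hgf, hg, rfl⟩ := h'
  have hmem : f - g ∈ Ideal.span {G} := by
    rw [← hker, RingHom.mem_ker, map_sub, hgf, sub_self]
  obtain ⟨h, hh⟩ := Ideal.mem_span_singleton'.mp hmem
  have hle : WeightLE w γ (f - g) := by
    simpa [sub_eq_add_neg] using hf.add (hg.smul (-1))
  rw [← sub_eq_zero, ← map_sub, ← map_sub, ← hh]
  rcases eq_or_ne h 0 with rfl | hne
  · simp
  obtain ⟨m, -, hm, hm0⟩ := exists_weightLE_component_ne_zero w hne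
  have hle' : Finsupp.weight w m + γ₀ ≤ γ := by
    by_contra! hlt
    have := hle.component_eq_zero hlt
    rw [← hh, hm.component_mul hG] at this
    exact mul_ne_zero hm0 hG0 this
  have := (hm.mono (le_sub_iff_add_le.mpr hle')).component_mul hG
  rw [sub_add_cancel] at this
  rw [this, map_mul, hGε, mul_zero]

end IsLead

end Lead

/-! ### Coefficients of exponential maps -/

section Exponential

variable {k A : Type*} [CommRing k] [CommRing A] [Algebra k A] {φ : A →ₐ[k] A[X]}

/-- The coefficients of an exponential map form an iterative system: this is the law
`φ_V ∘ φ_U = φ_{V+U}` read off coefficientwise. -/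
theorem IsExponentialMap.coeff_coeff (hφ : IsExponentialMap φ) (a : A) (i j : ℕ) :
    (φ ((φ a).coeff i)).coeff j = ((i + j).choose i : A) * (φ a).coeff (i + j) := by
  have h := congrArg (fun P : A[X][X] => (P.coeff i).coeff j) (hφ.comp a)
  simp only [Polynomial.coeff_map, RingHom.coe_coe, Polynomial.aeval_eq_sum_range,
    Polynomial.finsetSum_coeff, Polynomial.coeff_smul, add_comm (Polynomial.C Polynomial.X),
    Polynomial.coeff_X_add_C_pow, smul_eq_mul] at h
  rw [h]
  have hz : ∀ n ∈ Finset.range ((φ a).natDegree + 1), n ≠ i + j →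
      (φ a).coeff n * ((Polynomial.X : A[X]) ^ (n - i) * (n.choose i : A[X])).coeff j = 0 := by
    intro n _ hn
    rw [← Polynomial.C_eq_natCast, Polynomial.coeff_mul_C, Polynomial.coeff_X_pow]
    rcases lt_or_ge n i with hlt | hle
    · simp [Nat.choose_eq_zero_of_lt hlt]
    · rw [if_neg (by omega)]; simp
  rw [Finset.sum_eq_single (i + j) hz]
  · rw [← Polynomial.C_eq_natCast, Polynomial.coeff_mul_C, Polynomial.coeff_X_pow,
      if_pos (by omega), one_mul, mul_comm]
  · intro hn
    rw [Polynomial.coeff_eq_zero_of_natDegree_lt (by simpa using hn), zero_mul]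

end Exponential

/-! ### Symbols of exponential maps -/

section Symbol

variable {k σ A : Type*} [Field k] [CommRing A] [Algebra k A]

/-- `p` is the symbol of weight `γ` of the polynomial `P` over `A`, when the variable of `A[X]`
has weight `-δ`: the coefficients of `p` are the leading values of those of `P`. -/
def HasSymbol (π : MvPolynomial σ k →ₐ[k] A) (w : σ → ℝ) (ε : σ → k) (δ γ : ℝ) (P : A[X])
    (p : k[X]) : Prop :=
  ∀ i : ℕ, IsLead π w ε (γ + i * δ) (P.coeff i) (p.coeff i)

variable {π : MvPolynomial σ k →ₐ[k] A} {w : σ → ℝ} {ε : σ → k} {δ γ γ' : ℝ} {P Q : A[X]}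
  {p q : k[X]} {φ : A →ₐ[k] A[X]} {c : k} {d : A}

namespace HasSymbol

theorem zero : HasSymbol π w ε δ γ 0 0 := fun i => by simpa using IsLead.zero

theorem one : HasSymbol π w ε δ 0 1 1 := by
  have h1 : IsLead π w ε 0 1 1 := by simpa using IsLead.of_monomial π w ε 0
  intro i
  rcases eq_or_ne i 0 with rfl | hi
  · simpa using h1
  · simpa [Polynomial.coeff_one, hi] using IsLead.zero

theorem add (h : HasSymbol π w ε δ γ P p) (h' : HasSymbol π w ε δ γ Q q) :
    HasSymbol π w ε δ γ (P + Q) (p + q) := fun i => by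
  simpa using (h i).add (h' i)

theorem smul (r : k) (h : HasSymbol π w ε δ γ P p) : HasSymbol π w ε δ γ (r • P) (r • p) :=
  fun i => by simpa using (h i).smul r

theorem mul (h : HasSymbol π w ε δ γ P p) (h' : HasSymbol π w ε δ γ' Q q) :
    HasSymbol π w ε δ (γ + γ') (P * Q) (p * q) := fun i => by
  rw [Polynomial.coeff_mul, Polynomial.coeff_mul]
  refine IsLead.sum _ fun x hx => ?_
  have := (h x.1).mul (h' x.2)
  rwa [show γ + x.1 * δ + (γ' + x.2 * δ) = γ + γ' + i * δ by
    rw [← Finset.HasAntidiagonal.mem_antidiagonal.mp hx]; push_cast; ring] at this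

theorem pow (h : HasSymbol π w ε δ γ P p) (n : ℕ) :
    HasSymbol π w ε δ (n * γ) (P ^ n) (p ^ n) := by
  induction n with
  | zero => simpa using one
  | succ n ih =>
    rw [pow_succ, pow_succ]
    have := ih.mul h
    rwa [show n * γ + γ = (n + 1 : ℕ) * γ by push_cast; ring] at this

theorem of_lt (h : HasSymbol π w ε δ γ P p) (hγ : γ < γ') : HasSymbol π w ε δ γ' P 0 :=
  fun i => by simpa using (h i).of_lt (by linarith)

/-- Symbols of the images of the variables multiply to symbols of the images of monomials. -/
theorem monomial {p : σ → k[X]}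
    (h : ∀ s, HasSymbol π w ε δ (w s) (φ (π (MvPolynomial.X s))) (p s)) (m : σ →₀ ℕ) :
    HasSymbol π w ε δ (Finsupp.weight w m) (φ (π (MvPolynomial.monomial m 1)))
      (m.prod fun s e => p s ^ e) := by
  classical
  induction m using Finsupp.induction with
  | zero => simpa using one
  | single_add s n f hs hn ih =>
    rw [map_add, ← mul_one (1 : k), ← MvPolynomial.monomial_mul, map_mul, map_mul,
      Finsupp.prod_add_index' (by simp) (by simp [pow_add])]
    refine HasSymbol.mul ?_ ih
    have := (h s).pow n
    rw [Finsupp.prod_single_index (by simp), Finsupp.weight_single, nsmul_eq_mul]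
    rwa [← map_pow, ← map_pow, MvPolynomial.X_pow_eq_monomial] at this

/-- The image under `φ` of an element of weight at most `γ` has a symbol of weight `γ`. -/
theorem exists_of_weightLE {p : σ → k[X]}
    (h : ∀ s, HasSymbol π w ε δ (w s) (φ (π (MvPolynomial.X s))) (p s))
    {f : MvPolynomial σ k} (hf : WeightLE w γ f) : ∃ q, HasSymbol π w ε δ γ (φ (π f)) q := by
  classical
  have hsum : ∀ s ⊆ f.support, ∃ q, HasSymbol π w ε δ γ
      (φ (π (∑ m ∈ s, MvPolynomial.monomial m (f.coeff m)))) q := by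
    intro s
    induction s using Finset.induction_on with
    | empty => exact fun _ => ⟨0, by simpa using zero⟩
    | insert m s hm ih =>
      intro hs
      obtain ⟨q, hq⟩ := ih fun x hx => hs (by simp [hx])
      have hm' : ∃ q, HasSymbol π w ε δ γ (φ (π (MvPolynomial.monomial m (1 : k)))) q := by
        rcases (hf m (hs (by simp))).eq_or_lt with he | hlt
        · exact ⟨_, he ▸ monomial h m⟩
        · exact ⟨0, (monomial h m).of_lt hlt⟩
      obtain ⟨q', hq'⟩ := hm'
      refine ⟨f.coeff m • q' + q, ?_⟩
      rw [Finset.sum_insert hm, map_add, map_add]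
      refine HasSymbol.add ?_ hq
      have := hq'.smul (f.coeff m)
      rwa [← map_smul, ← map_smul, MvPolynomial.smul_monomial, smul_eq_mul, mul_one] at this
  simpa [← MvPolynomial.as_sum f] using hsum _ subset_rfl

/-- The symbol of `φ d` depends only on the leading value of `d`. -/
theorem of_isLead {p : σ → k[X]}
    (hU : ∀ γ d c c', IsLead π w ε γ d c → IsLead π w ε γ d c' → c = c')
    (hE : ∀ d, d ≠ 0 → ∃ m : σ →₀ ℕ, ∃ c, c ≠ 0 ∧ IsLead π w ε (Finsupp.weight w m) d c)
    (hε : ∀ s, ε s ≠ 0)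
    (h : ∀ s, HasSymbol π w ε δ (w s) (φ (π (MvPolynomial.X s))) (p s)) {m : σ →₀ ℕ}
    (hd : IsLead π w ε (Finsupp.weight w m) d c) :
    HasSymbol π w ε δ (Finsupp.weight w m) (φ d)
      ((c / m.prod fun s e => ε s ^ e) • m.prod fun s e => p s ^ e) := by
  set u := m.prod fun s e => ε s ^ e with hu
  have hu0 : u ≠ 0 := Finset.prod_ne_zero_iff.mpr fun s _ => pow_ne_zero _ (hε s)
  set x := π (MvPolynomial.monomial m 1) with hx
  have hx' : IsLead π w ε (Finsupp.weight w m) x u := IsLead.of_monomial π w ε m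
  have hr : IsLead π w ε (Finsupp.weight w m) (d - (c / u) • x) 0 := by
    have := hd.add (hx'.smul (-(c / u)))
    rwa [neg_smul, ← sub_eq_add_neg, neg_mul, div_mul_cancel₀ _ hu0, add_neg_cancel] at this
  have hs : HasSymbol π w ε δ (Finsupp.weight w m) (φ (d - (c / u) • x)) 0 := by
    rcases eq_or_ne (d - (c / u) • x) 0 with h0 | h0
    · rw [h0, map_zero]; exact zero
    obtain ⟨m', c', hc', hm'⟩ := hE _ h0
    -- the difference has leading value `0` in weight `m`, so its true weight is smaller
    have hlt : Finsupp.weight w m' < Finsupp.weight w m := by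
      by_contra! hle
      rcases hle.eq_or_lt with he | hlt
      · exact hc' (hU _ _ _ _ hm' (he ▸ hr))
      · exact hc' (hU _ _ _ _ hm' (hr.of_lt hlt))
    obtain ⟨f, hf, hle, -⟩ := hm'
    obtain ⟨q, hq⟩ := exists_of_weightLE h hle
    rw [hf] at hq
    exact hq.of_lt hlt
  have := hs.add ((monomial h m).smul (c / u))
  rwa [zero_add, ← map_smul φ, ← map_add, sub_add_cancel] at this

end HasSymbol

/-- The leading parts of a nontrivial exponential map. There are a slope `δ` and polynomials
`p s`, the symbols of the images of the variables, not all constant, such that a nonzero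
coefficient of degree `n` in a monomial `p ^ m` forces `weight m + n * δ` to be the weight of a
monomial `m'`; for the top coefficient, `p ^ m'` is moreover constant. -/
theorem IsExponentialMap.exists_symbols [Finite σ] (hφ : IsExponentialMap φ)
    (hnt : expInvariants φ ≠ ⊤) (hπ : Function.Surjective π)
    (hU : ∀ γ d c c', IsLead π w ε γ d c → IsLead π w ε γ d c' → c = c')
    (hE : ∀ d, d ≠ 0 → ∃ m : σ →₀ ℕ, ∃ c, c ≠ 0 ∧ IsLead π w ε (Finsupp.weight w m) d c)
    (hε : ∀ s, ε s ≠ 0) :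
    ∃ (δ : ℝ) (p : σ → k[X]),
      (∀ s, HasSymbol π w ε δ (w s) (φ (π (MvPolynomial.X s))) (p s)) ∧
      (∃ s, (p s).natDegree ≠ 0) ∧ (∀ s, (p s).coeff 0 ≠ 0) ∧
      ∀ (m : σ →₀ ℕ) (n : ℕ), (m.prod fun s e => p s ^ e).coeff n ≠ 0 →
        ∃ m' : σ →₀ ℕ, Finsupp.weight w m' = Finsupp.weight w m + n * δ ∧
          (n = (m.prod fun s e => p s ^ e).natDegree →
            (m'.prod fun s e => p s ^ e).natDegree = 0) := by
  classical
  have hX : ∀ s, IsLead π w ε (w s) (π (MvPolynomial.X s)) (ε s) := fun s => by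
    have := IsLead.of_monomial π w ε (Finsupp.single s 1)
    rwa [Finsupp.weight_single, one_smul, Finsupp.prod_single_index (by simp), pow_one,
      ← MvPolynomial.X] at this
  have hφ0 : ∀ a, (φ a).coeff 0 = a := fun a => by
    rw [Polynomial.coeff_zero_eq_eval_zero, hφ.eval_zero]
  let T : Set (σ × ℕ) := {x | x.2 ≠ 0 ∧ (φ (π (MvPolynomial.X x.1))).coeff x.2 ≠ 0}
  have hTfin : T.Finite := by
    refine (Set.finite_univ.prod (Set.finite_iUnion fun s =>
      (φ (π (MvPolynomial.X s))).support.finite_toSet)).subset fun x hx => ?_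
    exact ⟨trivial, Set.mem_iUnion.mpr ⟨x.1, Polynomial.mem_support_iff.mpr hx.2⟩⟩
  have hTne : T.Nonempty := by
    by_contra hT
    refine hnt (eq_top_iff.mpr fun a _ => ?_)
    obtain ⟨f, rfl⟩ := hπ a
    have : φ.comp π = Polynomial.CAlgHom.comp π := by
      refine MvPolynomial.algHom_ext fun s => ?_
      ext (_ | i)
      · simp [hφ0]
      · have : ((s, i + 1) : σ × ℕ) ∉ T := fun h => hT ⟨_, h⟩
        simpa [T, Polynomial.coeff_C] using this
    exact DFunLike.congr_fun this f
  have hex : ∀ x : σ × ℕ, ∃ γ : ℝ, x ∈ T → ∃ c, c ≠ 0 ∧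
      IsLead π w ε γ ((φ (π (MvPolynomial.X x.1))).coeff x.2) c := fun x => by
    by_cases hx : x ∈ T
    · obtain ⟨m, hm⟩ := hE _ hx.2
      exact ⟨_, fun _ => hm⟩
    · exact ⟨0, fun h => (hx h).elim⟩
  choose v hv using hex
  -- the slope is the largest growth of weight per degree over all coefficients of generators
  obtain ⟨⟨s₀, i₀⟩, hx₀, hmax⟩ := T.exists_max_image (fun x => (v x - w x.1) / x.2) hTfin hTne
  set δ : ℝ := (v (s₀, i₀) - w s₀) / i₀ with hδ
  have hle : ∀ x ∈ T, v x ≤ w x.1 + x.2 * δ := fun x hx => by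
    have h1 := hmax x hx
    have h2 : (0 : ℝ) < x.2 := by exact_mod_cast Nat.pos_of_ne_zero hx.1
    rw [div_le_iff₀ h2] at h1
    linarith
  have hi₀ : (i₀ : ℝ) ≠ 0 := by exact_mod_cast hx₀.1
  have hv₀ : v (s₀, i₀) = w s₀ + i₀ * δ := by rw [hδ]; field_simp; ring
  have hc : ∀ s (i : ℕ), ∃ c, IsLead π w ε (w s + i * δ)
      ((φ (π (MvPolynomial.X s))).coeff i) c := fun s i => by
    rcases eq_or_ne i 0 with rfl | hi
    · exact ⟨ε s, by simpa [hφ0] using hX s⟩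
    by_cases h0 : (φ (π (MvPolynomial.X s))).coeff i = 0
    · exact ⟨0, h0 ▸ IsLead.zero⟩
    obtain ⟨c, -, hc⟩ := hv (s, i) ⟨hi, h0⟩
    rcases (hle (s, i) ⟨hi, h0⟩).eq_or_lt with he | hlt
    · exact ⟨c, by simpa [he] using hc⟩
    · exact ⟨0, hc.of_lt hlt⟩
  choose c hc using hc
  let p : σ → k[X] := fun s => ∑ i ∈ Finset.range ((φ (π (MvPolynomial.X s))).natDegree + 1),
    Polynomial.monomial i (c s i)
  have hp : ∀ s i, (p s).coeff i = c s i := fun s i => by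
    simp only [p, Polynomial.finsetSum_coeff, Polynomial.coeff_monomial]
    rw [Finset.sum_ite_eq' (Finset.range _) i]
    split_ifs with hi
    · rfl
    · have h0 := hc s i
      rw [Polynomial.coeff_eq_zero_of_natDegree_lt (by simpa using hi)] at h0
      exact hU _ _ _ _ IsLead.zero h0
  have hS : ∀ s, HasSymbol π w ε δ (w s) (φ (π (MvPolynomial.X s))) (p s) := fun s i => by
    rw [hp]; exact hc s i
  refine ⟨δ, p, hS, ⟨s₀, fun hdeg => ?_⟩, fun s => ?_, fun m n hn => ?_⟩
  · obtain ⟨c', hc', hl⟩ := hv _ hx₀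
    rw [hv₀] at hl
    refine hc' ((hU _ _ _ _ hl (hS s₀ i₀)).trans ?_)
    exact Polynomial.coeff_eq_zero_of_natDegree_lt (hdeg ▸ Nat.pos_of_ne_zero hx₀.1)
  · have := hS s 0
    rw [hφ0, Nat.cast_zero, zero_mul, add_zero] at this
    rw [hU _ _ _ _ this (hX s)]
    exact hε s
  · set q := m.prod fun s e => p s ^ e with hq
    set a := π (MvPolynomial.monomial m 1) with ha
    have hsym := HasSymbol.monomial hS m
    rw [← hq, ← ha] at hsym
    have hlead := hsym n
    have hne : (φ a).coeff n ≠ 0 := fun h0 => by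
      rw [h0] at hlead
      exact hn (hU _ _ _ _ hlead IsLead.zero)
    obtain ⟨m', c', hc', hm'⟩ := hE _ hne
    have hwt : Finsupp.weight w m' = Finsupp.weight w m + n * δ := by
      rcases lt_trichotomy (Finsupp.weight w m') (Finsupp.weight w m + n * δ) with h | h | h
      · exact (hn (hU _ _ _ _ hlead (hm'.of_lt h))).elim
      · exact h
      · exact (hc' (hU _ _ _ _ hm' (hlead.of_lt h))).elim
    refine ⟨m', hwt, fun hdeg => ?_⟩
    have hsym' := HasSymbol.of_isLead hU hE hε hS hm'
    have hu0 : (m'.prod fun s e => ε s ^ e) ≠ 0 :=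
      Finset.prod_ne_zero_iff.mpr fun s _ => pow_ne_zero _ (hε s)
    rw [Polynomial.natDegree_eq_zero_iff_degree_le_zero, Polynomial.degree_le_zero_iff]
    ext (_ | j)
    · simp
    -- by the iterative law the coefficient of degree `j + 1` comes from that of degree
    -- `n + (j + 1)` in `q`, which vanishes
    have h1 := hsym' (j + 1)
    have h2 := (hsym (n + (j + 1))).smul ((n + (j + 1)).choose n : k)
    rw [hφ.coeff_coeff, hwt] at h1
    rw [Algebra.smul_def, map_natCast, show Finsupp.weight w m + ((n + (j + 1) : ℕ) : ℝ) * δ =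
      Finsupp.weight w m + n * δ + ((j + 1 : ℕ) : ℝ) * δ by push_cast; ring] at h2
    have h3 := hU _ _ _ _ h1 h2
    rw [Polynomial.coeff_eq_zero_of_natDegree_lt (show q.natDegree < n + (j + 1) by omega),
      mul_zero, Polynomial.coeff_smul, smul_eq_mul] at h3
    rw [Polynomial.coeff_C_succ]
    exact (mul_eq_zero.mp h3).resolve_left (div_ne_zero hc' hu0)

end Symbol

/-! ### Powers of polynomials in one variable -/

section Power

/-- If `P` has degree `e > 0` and nonzero constant term, and `n` is invertible in `k`, then below
its leading term `P ^ n` has a term of degree at least `(n - 1) * e`: the second term of `P ^ n` is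
`n * lc ^ (n - 1) * X ^ ((n - 1) * e)` times the second term of `P`. -/
theorem Polynomial.exists_coeff_pow_ne_zero {k : Type*} [Field k] {P : k[X]} {n : ℕ}
    (hn : (n : k) ≠ 0) (h0 : P.coeff 0 ≠ 0) (hP : P.natDegree ≠ 0) :
    ∃ j, (n - 1) * P.natDegree ≤ j ∧ j < n * P.natDegree ∧ (P ^ n).coeff j ≠ 0 := by
  set e := P.natDegree with he
  set r := P.leadingCoeff with hr
  have hr0 : r ≠ 0 := by
    rw [hr, Polynomial.leadingCoeff_ne_zero]; rintro rfl; simp at h0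
  have hn0 : n ≠ 0 := by rintro rfl; simp at hn
  set M : k[X] := Polynomial.C r * Polynomial.X ^ e with hM
  have hMdeg : M.natDegree ≤ e := Polynomial.natDegree_C_mul_X_pow_le r e
  have hMe : M.coeff e = r := by simp [hM]
  set S : k[X] := ∑ i ∈ Finset.range n, P ^ i * M ^ (n - 1 - i) with hS
  have hfac : S * (P - M) = P ^ n - M ^ n := (Commute.all P M).geom_sum₂_mul n
  -- each of the `n` summands of `S` contributes `r ^ (n - 1)` in degree `(n - 1) * e`
  have hScoeff : S.coeff ((n - 1) * e) = n * r ^ (n - 1) := by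
    rw [hS, Polynomial.finsetSum_coeff, Finset.sum_congr rfl (g := fun _ => r ^ (n - 1)),
      Finset.sum_const, Finset.card_range, nsmul_eq_mul]
    intro i hi
    have hi' : i + (n - 1 - i) = n - 1 := by have := Finset.mem_range.mp hi; omega
    have h1 : (P ^ i).natDegree ≤ i * e := Polynomial.natDegree_pow_le
    have h2 : (M ^ (n - 1 - i)).natDegree ≤ (n - 1 - i) * e :=
      Polynomial.natDegree_pow_le_of_le _ hMdeg
    have h3 := Polynomial.coeff_mul_add_eq_of_natDegree_le h1 h2
    rw [← add_mul, hi'] at h3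
    rw [h3, Polynomial.coeff_pow_of_natDegree_le le_rfl,
      Polynomial.coeff_pow_of_natDegree_le hMdeg, hMe]
    exact (pow_add r _ _).symm.trans (congrArg _ hi')
  have hSdeg : (n - 1) * e ≤ S.natDegree :=
    Polynomial.le_natDegree_of_ne_zero (hScoeff ▸ mul_ne_zero hn (pow_ne_zero _ hr0))
  have hS0 : S ≠ 0 := fun h => by
    rw [h, Polynomial.coeff_zero] at hScoeff
    exact mul_ne_zero hn (pow_ne_zero _ hr0) hScoeff.symm
  have hN0 : P - M ≠ 0 := fun h => by
    have := congrArg (Polynomial.coeff · 0) h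
    simp [hM, Polynomial.coeff_X_pow, hP.symm] at this
    exact h0 this
  have hD0 : P ^ n - M ^ n ≠ 0 := hfac ▸ mul_ne_zero hS0 hN0
  set j := (P ^ n - M ^ n).natDegree with hj
  have hle : j ≤ n * e := (Polynomial.natDegree_sub_le _ _).trans
    (max_le Polynomial.natDegree_pow_le (Polynomial.natDegree_pow_le_of_le _ hMdeg))
  have hjc : (P ^ n - M ^ n).coeff j ≠ 0 := by
    rw [hj, Polynomial.coeff_natDegree]; exact Polynomial.leadingCoeff_ne_zero.mpr hD0
  have hne : j ≠ n * e := fun h => by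
    rw [h, Polynomial.coeff_sub, Polynomial.coeff_pow_of_natDegree_le le_rfl,
      Polynomial.coeff_pow_of_natDegree_le hMdeg, hMe] at hjc
    exact hjc (sub_self _)
  refine ⟨j, ?_, lt_of_le_of_ne hle hne, fun h => hjc ?_⟩
  · rw [hj, ← hfac, Polynomial.natDegree_mul hS0 hN0]
    omega
  · rw [Polynomial.coeff_sub, h, hM, mul_pow, ← Polynomial.C_pow, ← pow_mul,
      Polynomial.coeff_C_mul, Polynomial.coeff_X_pow, if_neg (by rwa [mul_comm]), mul_zero,
      sub_zero]

theorem Polynomial.exists_associated_pow_of_associated_pow_pow {k : Type*} [Field k] {p q : k[X]}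
    {a c : ℕ} (ha : 0 < a) (hac : a.Coprime c) (h : Associated (p ^ a) (q ^ c)) :
    ∃ P : k[X], Associated p (P ^ c) ∧ Associated q (P ^ a) := by
  classical
  have h1 : normalize p ^ a = normalize q ^ c := by
    rw [← coe_normalizeHom, ← map_pow, ← map_pow]
    exact normalize_eq_normalize_iff_associated.mpr h
  let ι := algebraMap k[X] (FractionRing k[X])
  have h2 : ι (normalize p) ^ a = ι (normalize q) ^ c := by rw [← map_pow, h1, map_pow]
  obtain ⟨x, hp, hq⟩ := (pow_eq_pow_iff_of_coprime hac).mp h2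
  obtain ⟨P, rfl⟩ := IsIntegrallyClosed.exists_algebraMap_eq_of_isIntegral_pow (R := k[X]) ha
    (hq ▸ isIntegral_algebraMap)
  have hinj : Function.Injective ι := IsFractionRing.injective _ _
  refine ⟨P, ?_, ?_⟩
  · rw [← hinj (hp.trans (map_pow _ _ _).symm)]; exact associated_normalize p
  · rw [← hinj (hq.trans (map_pow _ _ _).symm)]; exact associated_normalize q

end Power

/-! ### Nonexistence of nonconstant symbols -/

section Symbols

variable {k : Type*} [Field k] {a b c : ℕ} {η ζ δ : ℝ} {x y z : k[X]}

/-- The case of `symbols_false` in which `y` is the constant symbol. The relation and the key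
property force `a` and `c` to be coprime and `x`, `z` to be, up to constants, powers `P ^ c`,
`P ^ a` of one polynomial. One of `a`, `c` is invertible in `k`, so one of these powers has a second
term; its weight is too close to that of the leading term to be the weight of a monomial, since the
coefficient of `ζ` in such a weight lies in the semigroup generated by `a, c ≥ 2`. -/
theorem symbols_false_of_natDegree_eq_zero (ha : 2 ≤ a) (hc : 2 ≤ c)
    (habc : Nat.gcd (Nat.gcd a b) c = 1)
    (hlin : ∀ r s : ℤ, r * η + s * ζ = 0 → r = 0 ∧ s = 0)
    (hx : x.coeff 0 ≠ 0) (hy : y.coeff 0 ≠ 0) (hz : z.coeff 0 ≠ 0)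
    (hrel : x ^ a + y ^ b * z ^ c = 0)
    (hkey : ∀ i j l n : ℕ, (x ^ i * y ^ j * z ^ l).coeff n ≠ 0 → ∃ i' j' l' : ℕ,
      i' * (b * η + c * ζ) + j' * (a * η) + l' * (a * ζ) =
        i * (b * η + c * ζ) + j * (a * η) + l * (a * ζ) + n * δ ∧
      (n = (x ^ i * y ^ j * z ^ l).natDegree → (x ^ i' * y ^ j' * z ^ l').natDegree = 0))
    (hyd : y.natDegree = 0) (hzd : z.natDegree ≠ 0) : False := by
  have hx0 : x ≠ 0 := by rintro rfl; simp at hx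
  have hy0 : y ≠ 0 := by rintro rfl; simp at hy
  have hz0 : z ≠ 0 := by rintro rfl; simp at hz
  have hdeg : ∀ i j l : ℕ, (x ^ i * y ^ j * z ^ l).natDegree =
      i * x.natDegree + l * z.natDegree := fun i j l => by
    rw [Polynomial.natDegree_mul (by simp [hx0, hy0]) (by simp [hz0]),
      Polynomial.natDegree_mul (by simp [hx0]) (by simp [hy0]), Polynomial.natDegree_pow,
      Polynomial.natDegree_pow, Polynomial.natDegree_pow, hyd]
    ring
  have hrel' : x ^ a = -(y ^ b * z ^ c) := eq_neg_of_add_eq_zero_left hrel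
  have hxz : a * x.natDegree = c * z.natDegree := by
    have := hdeg 0 b c
    rw [pow_zero, one_mul, ← Polynomial.natDegree_neg, ← hrel', Polynomial.natDegree_pow] at this
    simpa using this
  have hxd : x.natDegree ≠ 0 := fun h => by
    rw [h, mul_zero] at hxz
    exact (mul_ne_zero (by omega) hzd) hxz.symm
  have hη : η ≠ 0 := fun h => by simpa using (hlin 1 0 (by simp [h])).1
  have hconst : ∀ i' j' l' : ℕ, (x ^ i' * y ^ j' * z ^ l').natDegree = 0 → i' = 0 ∧ l' = 0 := by
    intro i' j' l' h
    rw [hdeg, Nat.add_eq_zero_iff] at h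
    simpa [hxd, hzd] using h
  have hlead : ∀ p : k[X], p ≠ 0 → p.coeff p.natDegree ≠ 0 := fun p hp => by
    rwa [Polynomial.coeff_natDegree, Polynomial.leadingCoeff_ne_zero]
  -- the top coefficients of `z` and `x` lead to powers of the only constant symbol, `y`
  obtain ⟨i₁, s, l₁, hs, hs0⟩ := hkey 0 0 1 z.natDegree (by simpa using hlead z hz0)
  obtain ⟨rfl, rfl⟩ := hconst _ _ _ (hs0 (by simp))
  obtain ⟨i₂, t, l₂, ht, ht0⟩ := hkey 1 0 0 x.natDegree (by simpa using hlead x hx0)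
  obtain ⟨rfl, rfl⟩ := hconst _ _ _ (ht0 (by simp))
  push_cast at hs ht
  have hxzR : (a : ℝ) * x.natDegree = c * z.natDegree := by exact_mod_cast hxz
  have haR : (a : ℝ) ≠ 0 := by exact_mod_cast (by omega : a ≠ 0)
  have hbR : (b : ℝ) + c * s = a * t := by
    have h1 : (a * η) * (b + c * s - a * t) = 0 := by
      linear_combination c * hs - a * ht - δ * hxzR
    have := (mul_eq_zero.mp h1).resolve_left (mul_ne_zero haR hη)
    linarith
  have hbN : b + c * s = a * t := by exact_mod_cast hbR
  -- a common divisor of `a` and `c` divides `b`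
  have hac : a.Coprime c := by
    have h1 : Nat.gcd a c ∣ b := (Nat.dvd_add_left ((Nat.gcd_dvd_right a c).mul_right s)).mp
      (hbN ▸ (Nat.gcd_dvd_left a c).mul_right t)
    refine Nat.dvd_one.mp (habc ▸ Nat.dvd_gcd (Nat.dvd_gcd ?_ h1) ?_)
    exacts [Nat.gcd_dvd_left a c, Nat.gcd_dvd_right a c]
  obtain ⟨e, he⟩ : a ∣ z.natDegree := hac.dvd_of_dvd_mul_left (hxz ▸ dvd_mul_right a _)
  have hxe : x.natDegree = c * e := by
    rw [he] at hxz
    exact Nat.eq_of_mul_eq_mul_left (by omega : 0 < a) (hxz.trans (by ring))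
  have he0 : e ≠ 0 := by rintro rfl; exact hzd (by simpa using he)
  have hδ : e * δ = s * η - ζ := by
    rw [he] at hs
    push_cast at hs
    refine mul_left_cancel₀ haR ?_
    linear_combination -hs
  -- so `x` and `z` are, up to constants, powers of one polynomial `P` of degree `e`
  have hass : Associated (x ^ a) (z ^ c) := by
    have hu : IsUnit (y ^ b) := IsUnit.pow b (by
      rw [Polynomial.eq_C_of_natDegree_eq_zero hyd]
      exact Polynomial.isUnit_C.mpr (isUnit_iff_ne_zero.mpr hy))
    rw [hrel']
    exact (associated_unit_mul_left _ _ hu).neg_left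
  obtain ⟨P, hxP, hzP⟩ := Polynomial.exists_associated_pow_of_associated_pow_pow (by omega) hac hass
  have hPd : P.natDegree = e := by
    have := Polynomial.natDegree_eq_of_degree_eq (Polynomial.degree_eq_degree_of_associated hzP)
    rw [Polynomial.natDegree_pow, he] at this
    exact (Nat.eq_of_mul_eq_mul_left (by omega) this).symm
  have hcoeff : ∀ {p q : k[X]}, Associated p q → ∀ n, q.coeff n ≠ 0 → p.coeff n ≠ 0 := by
    rintro p _ ⟨u, rfl⟩ n hn h
    obtain ⟨r, -, hr⟩ := Polynomial.isUnit_iff.mp u.isUnit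
    rw [← hr, Polynomial.coeff_mul_C, h, zero_mul] at hn
    exact hn rfl
  have hP0 : P.coeff 0 ≠ 0 := fun h => by
    refine hcoeff hzP.symm 0 hz ?_
    rw [Polynomial.coeff_zero_eq_eval_zero, Polynomial.eval_pow,
      ← Polynomial.coeff_zero_eq_eval_zero, h, zero_pow (by omega)]
  -- the second term of such a power is too close to the leading one
  have hgap : ∀ (d n : ℕ) (i j l : ℕ), 2 ≤ d → (d - 1) * e ≤ n → n < d * e → ∀ β : ℤ,
      i * (b * η + c * ζ) + j * (a * η) + l * (a * ζ) = β * η + d * ζ + n * δ → False := by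
    intro d n i j l hd hn1 hn2 β h
    -- compare the coefficients of `ζ`
    have h1 := (hlin (e * (i * b + j * a) - e * β - n * s)
      (e * (i * c + l * a) - e * d + n) (by
        push_cast
        linear_combination (e : ℝ) * h + n * hδ)).2
    have h2 : e * (i * c + l * a) + n = e * d := by
      have : ((e * (i * c + l * a) + n : ℕ) : ℤ) = (e * d : ℕ) := by push_cast; linarith
      exact_mod_cast this
    have h3 : i * c + l * a ≠ 0 := fun h0 => by
      rw [h0, mul_zero, zero_add, mul_comm e] at h2; omega
    have h4 : 2 ≤ i * c + l * a := by
      rcases Nat.eq_zero_or_pos i with rfl | hi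
      · rcases Nat.eq_zero_or_pos l with rfl | hl
        · simp at h3
        · nlinarith
      · nlinarith
    obtain ⟨d, rfl⟩ : ∃ d', d = d' + 1 := ⟨d - 1, by omega⟩
    rw [Nat.add_sub_cancel] at hn1
    have : 0 < e := Nat.pos_of_ne_zero he0
    nlinarith
  by_cases hak : (a : k) = 0
  · have hck : (c : k) ≠ 0 := fun hck => by
      obtain ⟨u, v, huv⟩ := Nat.isCoprime_iff_coprime.mpr hac
      have := congrArg (Int.cast : ℤ → k) huv
      push_cast at this
      simp [hak, hck] at this
    obtain ⟨n, hn1, hn2, hn⟩ :=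
      Polynomial.exists_coeff_pow_ne_zero hck hP0 (by rwa [hPd])
    rw [hPd] at hn1 hn2
    obtain ⟨i, j, l, h, -⟩ := hkey 1 0 0 n (by simpa using hcoeff hxP n hn)
    exact hgap c n i j l hc hn1 hn2 b (by push_cast at h ⊢; linear_combination h)
  · obtain ⟨n, hn1, hn2, hn⟩ :=
      Polynomial.exists_coeff_pow_ne_zero hak hP0 (by rwa [hPd])
    rw [hPd] at hn1 hn2
    obtain ⟨i, j, l, h, -⟩ := hkey 0 0 1 n (by simpa using hcoeff hzP n hn)
    exact hgap a n i j l ha hn1 hn2 0 (by push_cast at h ⊢; linear_combination h)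

/-- There are no polynomials `x`, `y`, `z`, not all constant, that satisfy the leading form of the
surface equation and behave as the symbols in `IsExponentialMap.exists_symbols`, for the weights
`b * η + c * ζ`, `a * η`, `a * ζ` of the variables with `η`, `ζ` independent over `ℤ`. -/
theorem symbols_false (ha : 2 ≤ a) (hb : 2 ≤ b) (hc : 2 ≤ c)
    (habc : Nat.gcd (Nat.gcd a b) c = 1)
    (hlin : ∀ r s : ℤ, r * η + s * ζ = 0 → r = 0 ∧ s = 0)
    (hx : x.coeff 0 ≠ 0) (hy : y.coeff 0 ≠ 0) (hz : z.coeff 0 ≠ 0)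
    (hrel : x ^ a + y ^ b * z ^ c = 0)
    (hkey : ∀ i j l n : ℕ, (x ^ i * y ^ j * z ^ l).coeff n ≠ 0 → ∃ i' j' l' : ℕ,
      i' * (b * η + c * ζ) + j' * (a * η) + l' * (a * ζ) =
        i * (b * η + c * ζ) + j * (a * η) + l * (a * ζ) + n * δ ∧
      (n = (x ^ i * y ^ j * z ^ l).natDegree → (x ^ i' * y ^ j' * z ^ l').natDegree = 0))
    (hne : x.natDegree ≠ 0 ∨ y.natDegree ≠ 0 ∨ z.natDegree ≠ 0) : False := by
  have hx0 : x ≠ 0 := by rintro rfl; simp at hx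
  have hy0 : y ≠ 0 := by rintro rfl; simp at hy
  have hz0 : z ≠ 0 := by rintro rfl; simp at hz
  have hdeg : ∀ i j l : ℕ, (x ^ i * y ^ j * z ^ l).natDegree =
      i * x.natDegree + j * y.natDegree + l * z.natDegree := fun i j l => by
    rw [Polynomial.natDegree_mul (by simp [hx0, hy0]) (by simp [hz0]),
      Polynomial.natDegree_mul (by simp [hx0]) (by simp [hy0]), Polynomial.natDegree_pow,
      Polynomial.natDegree_pow, Polynomial.natDegree_pow]
  have hrel' : x ^ a = -(y ^ b * z ^ c) := eq_neg_of_add_eq_zero_left hrel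
  have hxyz : a * x.natDegree = b * y.natDegree + c * z.natDegree := by
    have := hdeg 0 b c
    rw [pow_zero, one_mul, ← Polynomial.natDegree_neg, ← hrel', Polynomial.natDegree_pow] at this
    simpa using this
  by_cases hyd : y.natDegree = 0
  · by_cases hzd : z.natDegree = 0
    · have : x.natDegree = 0 := by
        rw [hyd, hzd, mul_zero, mul_zero, add_zero] at hxyz
        exact (mul_eq_zero.mp hxyz).resolve_left (by omega)
      simp_all
    · exact symbols_false_of_natDegree_eq_zero ha hc habc hlin hx hy hz hrel hkey hyd hzd
  by_cases hzd : z.natDegree = 0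
  · refine symbols_false_of_natDegree_eq_zero (η := ζ) (ζ := η) (δ := δ) ha hb
      (by rwa [Nat.gcd_assoc, Nat.gcd_comm c, ← Nat.gcd_assoc]) ?_ hx hz hy
      (by rwa [mul_comm]) ?_ hzd hyd
    · intro r s h
      exact (hlin s r (by rwa [add_comm])).symm
    · intro i j l n hn
      obtain ⟨i', j', l', h, h'⟩ := hkey i l j n (by rwa [mul_right_comm])
      refine ⟨i', l', j', by linear_combination h, fun hd => ?_⟩
      rw [mul_right_comm]
      exact h' (by rwa [mul_right_comm])
  -- if neither `y` nor `z` is constant, only the monomial `1` is, and the weights of both are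
  -- multiples of `δ`
  have hxd : x.natDegree ≠ 0 := fun h => by
    rw [h, mul_zero] at hxyz
    have := mul_ne_zero (by omega : b ≠ 0) hyd
    omega
  have hconst : ∀ i' j' l' : ℕ, (x ^ i' * y ^ j' * z ^ l').natDegree = 0 →
      i' = 0 ∧ j' = 0 ∧ l' = 0 := by
    intro i' j' l' h
    rw [hdeg, Nat.add_eq_zero_iff, Nat.add_eq_zero_iff] at h
    simpa [hxd, hyd, hzd, and_assoc] using h
  have hlead : ∀ p : k[X], p ≠ 0 → p.coeff p.natDegree ≠ 0 := fun p hp => by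
    rwa [Polynomial.coeff_natDegree, Polynomial.leadingCoeff_ne_zero]
  obtain ⟨i₁, j₁, l₁, h1, h1'⟩ := hkey 0 0 1 z.natDegree (by simpa using hlead z hz0)
  obtain ⟨rfl, rfl, rfl⟩ := hconst _ _ _ (h1' (by simp))
  obtain ⟨i₂, j₂, l₂, h2, h2'⟩ := hkey 0 1 0 y.natDegree (by simpa using hlead y hy0)
  obtain ⟨rfl, rfl, rfl⟩ := hconst _ _ _ (h2' (by simp))
  push_cast at h1 h2
  have := (hlin (a * z.natDegree) (-(a * y.natDegree)) (by
    push_cast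
    linear_combination y.natDegree * h1 - z.natDegree * h2)).1
  have : a * z.natDegree = 0 := by exact_mod_cast this
  exact mul_ne_zero (by omega) hzd this

end Symbols

/-! ### The surface ring -/

section Surface

open MvPolynomial

/-- A zero of `X ^ a + Y ^ b * Z ^ c` with nonzero coordinates; as one exponent is odd, signs
suffice. -/
theorem exists_signs (k : Type*) [Field k] {a b c : ℕ} (habc : Nat.gcd (Nat.gcd a b) c = 1) :
    ∃ ε : Fin 3 → k, (∀ s, ε s ≠ 0) ∧ ε 0 ^ a + ε 1 ^ b * ε 2 ^ c = 0 := by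
  have h : Odd a ∨ Odd b ∨ Odd c := by
    by_contra! h
    simp only [Nat.not_odd_iff_even, even_iff_two_dvd] at h
    have := Nat.dvd_gcd (Nat.dvd_gcd h.1 h.2.1) h.2.2
    omega
  rcases h with h | h | h
  · exact ⟨![-1, 1, 1], by simp [Fin.forall_fin_succ], by simp [h.neg_one_pow]⟩
  · exact ⟨![1, -1, 1], by simp [Fin.forall_fin_succ], by simp [h.neg_one_pow]⟩
  · exact ⟨![1, 1, -1], by simp [Fin.forall_fin_succ], by simp [h.neg_one_pow]⟩

/-- The weights of `X`, `Y`, `Z` that make `X ^ a` and `Y ^ b * Z ^ c` of equal weight, with `Y` of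
weight `a` and `Z` of weight `a * ξ`. -/
noncomputable def surfaceWeight (a b c : ℕ) (ξ : ℝ) : Fin 3 → ℝ := ![b + c * ξ, a, a * ξ]

theorem weight_surfaceWeight (a b c : ℕ) (ξ : ℝ) (m : Fin 3 →₀ ℕ) :
    Finsupp.weight (surfaceWeight a b c ξ) m = m 0 * (b + c * ξ) + m 1 * a + m 2 * (a * ξ) := by
  rw [Finsupp.weight_apply, Finsupp.sum_fintype _ _ (by simp), Fin.sum_univ_three]
  simp [surfaceWeight, mul_add]

theorem eq_zero_of_add_mul_irrational {ξ : ℝ} (hξ : Irrational ξ) {r s : ℤ} (h : r + s * ξ = 0) :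
    r = 0 ∧ s = 0 := by
  have hs : s = 0 := by
    by_contra hs
    exact ((hξ.intCast_mul hs).intCast_add r).ne_zero h
  subst hs
  exact ⟨by simpa using h, rfl⟩

/-- Monomials of degree less than `a` in `X` are separated by their weights. -/
theorem surfaceWeight_injOn {a b c : ℕ} (habc : Nat.gcd (Nat.gcd a b) c = 1) {ξ : ℝ}
    (hξ : Irrational ξ) :
    Set.InjOn (Finsupp.weight (surfaceWeight a b c ξ)) {m : Fin 3 →₀ ℕ | m 0 < a} := by
  intro m hm n hn h
  replace hm : m 0 < a := hm
  replace hn : n 0 < a := hn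
  rw [weight_surfaceWeight, weight_surfaceWeight] at h
  obtain ⟨h1, h2⟩ := eq_zero_of_add_mul_irrational hξ
    (r := ((m 0 : ℤ) - n 0) * b + a * ((m 1 : ℤ) - n 1))
    (s := ((m 0 : ℤ) - n 0) * c + a * ((m 2 : ℤ) - n 2))
    (by push_cast; linear_combination h)
  have hd : (a : ℤ) ∣ (m 0 : ℤ) - n 0 := by
    have hb : (a : ℤ) ∣ ((m 0 : ℤ) - n 0) * b := ⟨-((m 1 : ℤ) - n 1), by linear_combination h1⟩
    have hc : (a : ℤ) ∣ ((m 0 : ℤ) - n 0) * c := ⟨-((m 2 : ℤ) - n 2), by linear_combination h2⟩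
    have ha : (a : ℤ) ∣ ((m 0 : ℤ) - n 0) * a := dvd_mul_left _ _
    simp only [Int.natCast_dvd, Int.natAbs_mul, Int.natAbs_natCast] at ha hb hc
    have := Nat.dvd_gcd (Nat.dvd_gcd ha hb) hc
    rw [Nat.gcd_mul_left, Nat.gcd_mul_left, habc, mul_one] at this
    exact Int.natCast_dvd.mpr this
  have h0 : (m 0 : ℤ) - n 0 = 0 := by
    refine Int.eq_zero_of_abs_lt_dvd hd ?_
    rw [abs_lt]; constructor <;> omega
  have ha : (a : ℤ) ≠ 0 := by omega
  rw [h0, zero_mul, zero_add] at h1 h2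
  have h1 := (mul_eq_zero.mp h1).resolve_left ha
  have h2 := (mul_eq_zero.mp h2).resolve_left ha
  ext s
  fin_cases s
  · show m 0 = n 0; omega
  · show m 1 = n 1; omega
  · show m 2 = n 2; omega

variable {k : Type*} [Field k] {a b c : ℕ} {F : k[X]} {ξ : ℝ}

/-- The projection from the polynomial ring onto `SurfaceRing k a b c F`. -/
noncomputable abbrev surfaceMk (k : Type*) [Field k] (a b c : ℕ) (F : k[X]) :
    MvPolynomial (Fin 3) k →ₐ[k] SurfaceRing k a b c F :=
  Ideal.Quotient.mkₐ k (Ideal.span {surfacePoly a b c F})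

theorem surfaceMk_surfacePoly : surfaceMk k a b c F (surfacePoly a b c F) = 0 :=
  Ideal.Quotient.eq_zero_iff_mem.mpr (Ideal.mem_span_singleton_self _)

theorem ker_surfaceMk :
    RingHom.ker (surfaceMk k a b c F) = Ideal.span {surfacePoly a b c F} :=
  Ideal.Quotient.mkₐ_ker k _

/-- The equation rewrites `X ^ a` in terms of `Y` and `Z`, so it lowers the degree in `X` of a
monomial until that degree is less than `a`. -/
theorem surfaceMk_monomial_mem (ha : 0 < a) (n : ℕ) : ∀ m : Fin 3 →₀ ℕ, m 0 = n →
    surfaceMk k a b c F (monomial m 1) ∈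
      (restrictSupport k {m : Fin 3 →₀ ℕ | m 0 < a}).map (surfaceMk k a b c F).toLinearMap := by
  induction n using Nat.strong_induction_on with
  | _ n ih =>
    intro m hm
    rcases lt_or_ge (m 0) a with h | h
    · exact ⟨_, (monomial_mem_restrictSupport k).mpr (Or.inl h), rfl⟩
    obtain ⟨m', rfl⟩ : ∃ m', m = m' + Finsupp.single 0 a :=
      ⟨m - Finsupp.single 0 a, (tsub_add_cancel_of_le (by simpa using h)).symm⟩
    have hX : (monomial (m' + Finsupp.single 0 a) (1 : k)) = monomial m' 1 * surfacePoly a b c F -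
        (monomial (m' + (Finsupp.single 1 b + Finsupp.single 2 c)) 1 +
          ∑ t ∈ Finset.range (F.natDegree + 1),
            F.coeff t • monomial (m' + Finsupp.single 1 t) 1) := by
      have hmul : ∀ n, (monomial (m' + n) (1 : k)) = monomial m' 1 * monomial n 1 := fun n => by
        rw [monomial_mul, one_mul]
      have hmul' : monomial (Finsupp.single (1 : Fin 3) b + Finsupp.single 2 c) (1 : k) =
          X 1 ^ b * X 2 ^ c := by
        rw [X_pow_eq_monomial, X_pow_eq_monomial, monomial_mul, one_mul]
      simp only [hmul, hmul', ← X_pow_eq_monomial, ← mul_smul_comm, ← Finset.mul_sum, surfacePoly,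
        Polynomial.aeval_eq_sum_range]
      ring
    rw [hX, map_sub, map_mul, surfaceMk_surfacePoly, mul_zero, zero_sub, map_add, map_sum]
    simp only [Finsupp.add_apply, Finsupp.single_eq_same] at hm
    refine neg_mem (add_mem ?_ (sum_mem fun t _ => ?_))
    · exact ih (m' 0) (by omega) _ (by simp)
    · rw [map_smul]
      exact Submodule.smul_mem _ _ (ih (m' 0) (by omega) _ (by simp))

/-- Every element of the surface ring is represented by a polynomial of degree less than `a`
in `X`. -/
theorem exists_surfaceMk_eq (ha : 0 < a) (d : SurfaceRing k a b c F) :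
    ∃ f, surfaceMk k a b c F f = d ∧ ∀ m ∈ f.support, m 0 < a := by
  suffices h : (restrictSupport k {m : Fin 3 →₀ ℕ | m 0 < a}).map
      (surfaceMk k a b c F).toLinearMap = ⊤ by
    obtain ⟨f, hf, rfl⟩ := h.ge (Submodule.mem_top (x := d))
    exact ⟨f, rfl, hf⟩
  rw [eq_top_iff]
  rintro d -
  obtain ⟨f, rfl⟩ := Ideal.Quotient.mkₐ_surjective k _ d
  rw [f.as_sum, map_sum]
  refine sum_mem fun m _ => ?_
  rw [← mul_one (f.coeff m), ← smul_eq_mul, ← smul_monomial, map_smul]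
  exact Submodule.smul_mem _ _ (surfaceMk_monomial_mem ha _ m rfl)

/-- Every nonzero element has a nonzero leading value, in the weight of some monomial: the monomials
of a reduced representative have distinct weights, so the heaviest one cannot cancel. -/
theorem exists_isLead (ha : 0 < a) (habc : Nat.gcd (Nat.gcd a b) c = 1) (hξ : Irrational ξ)
    {ε : Fin 3 → k} (hε : ∀ s, ε s ≠ 0) (d : SurfaceRing k a b c F) (hd : d ≠ 0) :
    ∃ m : Fin 3 →₀ ℕ, ∃ u, u ≠ 0 ∧
      IsLead (surfaceMk k a b c F) (surfaceWeight a b c ξ) ε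
        (Finsupp.weight (surfaceWeight a b c ξ) m) d u := by
  classical
  obtain ⟨f, rfl, hred⟩ := exists_surfaceMk_eq ha d
  have hf : f ≠ 0 := by rintro rfl; exact hd (map_zero _)
  obtain ⟨m, hm, hle, -⟩ := exists_weightLE_component_ne_zero (surfaceWeight a b c ξ) hf
  refine ⟨m, _, ?_, f, rfl, hle, rfl⟩
  have : weightedHomogeneousComponent (surfaceWeight a b c ξ)
      (Finsupp.weight (surfaceWeight a b c ξ) m) f = monomial m (f.coeff m) := by
    ext n
    rw [coeff_weightedHomogeneousComponent, coeff_monomial]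
    by_cases hn : n ∈ f.support
    · have hiff := (surfaceWeight_injOn habc hξ).eq_iff (hred n hn) (hred m hm)
      by_cases hnm : n = m
      · simp [hnm]
      · rw [if_neg (mt hiff.mp hnm), if_neg (Ne.symm hnm)]
    · rw [notMem_support_iff.mp hn]
      have hnm : m ≠ n := by rintro rfl; exact hn hm
      simp [hnm]
  rw [this, eval_monomial]
  exact mul_ne_zero (mem_support_iff.mp hm)
    (Finset.prod_ne_zero_iff.mpr fun s _ => pow_ne_zero _ (hε s))

theorem weightLE_aeval_X_one (F : k[X]) :
    WeightLE (surfaceWeight a b c ξ) (F.natDegree * a)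
      (Polynomial.aeval (X 1 : MvPolynomial (Fin 3) k) F) := by
  rw [Polynomial.aeval_eq_sum_range]
  refine Finset.sum_induction _ (WeightLE (surfaceWeight a b c ξ) (F.natDegree * a))
    (fun _ _ => WeightLE.add) weightLE_zero fun t ht => ?_
  rw [X_pow_eq_monomial]
  refine ((weightLE_monomial _ _).mono ?_).smul _
  have : (t : ℝ) ≤ F.natDegree := by exact_mod_cast Nat.lt_succ_iff.mp (Finset.mem_range.mp ht)
  simpa [weight_surfaceWeight] using mul_le_mul_of_nonneg_right this (Nat.cast_nonneg a)

/-- The common weight of `X ^ a` and `Y ^ b * Z ^ c` exceeds the weight of `F(Y)`. -/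
theorem natDegree_mul_lt (ha : 2 ≤ a) (hc : 2 ≤ c) (hξF : F.natDegree < ξ) :
    (F.natDegree * a : ℝ) < a * (b + c * ξ) := by
  have ha' : (0 : ℝ) < a := by exact_mod_cast (by omega : 0 < a)
  have hc' : (2 : ℝ) ≤ c := by exact_mod_cast hc
  have hb' : (0 : ℝ) ≤ b := Nat.cast_nonneg b
  have hF : (0 : ℝ) ≤ F.natDegree := Nat.cast_nonneg _
  rw [mul_comm]
  exact mul_lt_mul_of_pos_left (by nlinarith) ha'

theorem isWeightedHomogeneous_leadingForm (k : Type*) [Field k] (a b c : ℕ) (ξ : ℝ) :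
    IsWeightedHomogeneous (surfaceWeight a b c ξ)
      (X 0 ^ a + X 1 ^ b * X 2 ^ c : MvPolynomial (Fin 3) k) (a * (b + c * ξ)) := by
  refine IsWeightedHomogeneous.add ?_ ?_
  · have := (isWeightedHomogeneous_X k (surfaceWeight a b c ξ) 0).pow a
    simpa [surfaceWeight, mul_add] using this
  · have := ((isWeightedHomogeneous_X k (surfaceWeight a b c ξ) 1).pow b).mul
      ((isWeightedHomogeneous_X k (surfaceWeight a b c ξ) 2).pow c)
    convert this using 1
    simp [surfaceWeight]
    ring

theorem weightLE_surfacePoly (ha : 2 ≤ a) (hc : 2 ≤ c) (hξF : F.natDegree < ξ) :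
    WeightLE (surfaceWeight a b c ξ) (a * (b + c * ξ)) (surfacePoly a b c F) := by
  refine WeightLE.add (fun m hm => ?_)
    ((weightLE_aeval_X_one F).mono (natDegree_mul_lt ha hc hξF).le)
  exact (isWeightedHomogeneous_leadingForm k a b c ξ (mem_support_iff.mp hm)).le

theorem component_surfacePoly (ha : 2 ≤ a) (hc : 2 ≤ c) (hξF : F.natDegree < ξ) :
    weightedHomogeneousComponent (surfaceWeight a b c ξ) (a * (b + c * ξ)) (surfacePoly a b c F) =
      X 0 ^ a + X 1 ^ b * X 2 ^ c := by
  rw [surfacePoly, map_add,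
    (weightLE_aeval_X_one F).component_eq_zero (natDegree_mul_lt ha hc hξF), add_zero,
    (isWeightedHomogeneous_leadingForm k a b c ξ).weightedHomogeneousComponent_same]

theorem isLead_unique (ha : 2 ≤ a) (hb : 2 ≤ b) (hc : 2 ≤ c) (hξF : F.natDegree < ξ)
    {ε : Fin 3 → k} (hε : ε 0 ^ a + ε 1 ^ b * ε 2 ^ c = 0) (γ : ℝ) (d : SurfaceRing k a b c F)
    (u u' : k) (h : IsLead (surfaceMk k a b c F) (surfaceWeight a b c ξ) ε γ d u)
    (h' : IsLead (surfaceMk k a b c F) (surfaceWeight a b c ξ) ε γ d u') : u = u' := by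
  have hcomp := component_surfacePoly (b := b) ha hc hξF
  refine IsLead.unique ker_surfaceMk (weightLE_surfacePoly ha hc hξF) ?_ ?_ h h'
  · rw [hcomp]
    intro h0
    -- the leading form takes the value `1` at `(1, 0, 0)`
    have := congrArg (eval ![1, 0, 0]) h0
    simp [zero_pow (by omega : b ≠ 0)] at this
  · rw [hcomp]
    simpa using hε

theorem isDomain_surfaceRing (ha : 2 ≤ a) (hb : 2 ≤ b) (hc : 2 ≤ c)
    (habc : Nat.gcd (Nat.gcd a b) c = 1) : IsDomain (SurfaceRing k a b c F) := by
  obtain ⟨ξ, hξ, hξF, -⟩ := exists_irrational_btwn (lt_add_one (F.natDegree : ℝ))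
  obtain ⟨ε, hε, hε0⟩ := exists_signs k habc
  have hU := isLead_unique ha hb hc hξF hε0
  have hE := exists_isLead (F := F) (by omega) habc hξ hε
  have : Nontrivial (SurfaceRing k a b c F) := by
    refine ⟨1, 0, fun h => ?_⟩
    have h1 := IsLead.of_monomial (surfaceMk k a b c F) (surfaceWeight a b c ξ) ε 0
    rw [← C_apply, map_one, map_one, h] at h1
    simpa using hU _ _ _ _ h1 IsLead.zero
  have : NoZeroDivisors (SurfaceRing k a b c F) := ⟨fun {d d'} h => by
    by_contra! hne
    obtain ⟨m, u, hu, hm⟩ := hE d hne.1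
    obtain ⟨m', u', hu', hm'⟩ := hE d' hne.2
    have := hm.mul hm'
    rw [h] at this
    exact mul_ne_zero hu hu' (hU _ _ _ _ this IsLead.zero)⟩
  exact NoZeroDivisors.to_isDomain _

theorem isRigid_surfaceRing (ha : 2 ≤ a) (hb : 2 ≤ b) (hc : 2 ≤ c)
    (habc : Nat.gcd (Nat.gcd a b) c = 1) : IsRigid k (SurfaceRing k a b c F) := by
  rintro ⟨φ, hφ, hnt⟩
  obtain ⟨ξ, hξ, hξF, -⟩ := exists_irrational_btwn (lt_add_one (F.natDegree : ℝ))
  obtain ⟨ε, hε, hε0⟩ := exists_signs k habc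
  have hU := isLead_unique ha hb hc hξF hε0
  have hE := exists_isLead (F := F) (by omega) habc hξ hε
  obtain ⟨δ, p, hS, ⟨s, hs⟩, hp0, hkey⟩ :=
    hφ.exists_symbols hnt (Ideal.Quotient.mkₐ_surjective k _) hU hE hε
  -- `F(Y)` has smaller weight than the rest of the equation, so it leaves no trace in the symbols
  have hrel : p 0 ^ a + p 1 ^ b * p 2 ^ c = 0 := by
    obtain ⟨q, hq⟩ := HasSymbol.exists_of_weightLE hS (weightLE_aeval_X_one F)
    have h0 := (hS 0).pow a
    have h12 := ((hS 1).pow b).mul ((hS 2).pow c)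
    have hw0 : a * surfaceWeight a b c ξ 0 = a * (b + c * ξ) := by simp [surfaceWeight]
    have hw12 : b * surfaceWeight a b c ξ 1 + c * surfaceWeight a b c ξ 2 = a * (b + c * ξ) := by
      simp [surfaceWeight]; ring
    rw [hw0] at h0
    rw [hw12] at h12
    have h := (h0.add h12).add (hq.of_lt (natDegree_mul_lt ha hc hξF))
    have hG : φ (surfaceMk k a b c F (surfacePoly a b c F)) = 0 := by
      rw [surfaceMk_surfacePoly, map_zero]
    simp only [surfacePoly, map_add, map_mul, map_pow] at hG
    rw [hG, add_zero] at h
    ext i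
    exact hU _ _ _ _ (h i) (HasSymbol.zero i)
  refine symbols_false (η := 1) (ζ := ξ) (δ := δ) ha hb hc habc
    (fun r s h => eq_zero_of_add_mul_irrational hξ (by simpa using h))
    (hp0 0) (hp0 1) (hp0 2) hrel ?_ ?_
  · have hprod : ∀ m : Fin 3 →₀ ℕ, (m.prod fun s e => p s ^ e) =
        p 0 ^ m 0 * p 1 ^ m 1 * p 2 ^ m 2 := fun m => by
      rw [Finsupp.prod_fintype _ _ (by simp), Fin.prod_univ_three]
    intro i j l n hn
    obtain ⟨m', hw, hd⟩ := hkey (Finsupp.equivFunOnFinite.symm ![i, j, l]) n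
      (by rw [hprod]; simpa using hn)
    rw [hprod, hprod] at hd
    rw [weight_surfaceWeight, weight_surfaceWeight] at hw
    refine ⟨m' 0, m' 1, m' 2, ?_, by simpa using hd⟩
    simpa using hw
  · by_contra! h
    fin_cases s
    exacts [hs h.1, hs h.2.1, hs h.2.2]

end Surface

theorem mainTheorem5 {k : Type*} [Field k] (a b c : ℕ) (ha : 2 ≤ a) (hb : 2 ≤ b) (hc : 2 ≤ c)
    (habc : Nat.gcd (Nat.gcd a b) c = 1) (F : k[X]) :
    IsDomain (SurfaceRing k a b c F) ∧ IsRigid k (SurfaceRing k a b c F) :=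
  ⟨isDomain_surfaceRing ha hb hc habc, isRigid_surfaceRing ha hb hc habc⟩
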